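/- Let $K$ be an arbitrary field of characteristic $p\ge 0$, let $R=K[x,y,z]$ with the standard grading, and let $\alpha,\beta,\gamma,t$ be non-negative integers with $$0<\alpha\le\beta\le\gamma\le 2(\alpha+\beta),\qquad t\ge\frac{\alpha+\beta+\gamma}{3},\qquad \alpha+\beta+\gamma\equiv 0 \pmod 3 .$$ Put $I=I_{\alpha,\beta,\gamma,t}=(x^{\alpha+t},\,y^{\beta+t},\,z^{\gamma+t},\,x^\alpha y^\beta z^\gamma)\subset R$, $s=\frac{\alpha+\beta+\gamma}{3}$ and $n=t+\frac{\alpha+\beta-2\gamma}{3}$. Then $n$ is a non-negative integer. Let $M$ be the $n\times n$ integer matrix with rows $i$ and columns $j$ numbered $0,\dots,n-1$ and entries $$M_{i,j}=\binom{\gamma}{s+i-j}\quad\text{for } 0\le i<t-s,\qquad M_{t-s+i',\,j}=\binom{\gamma+t}{t+\beta-1-i'-j}\quad\text{for } 0\le i'<\frac{2\alpha+2\beta-\gamma}{3},$$ where $\binom{m}{k}=0$ for $k<0$ or $k>m$ (and $\det M=1$ if $n=0$). The algebra $A=R/I$ is level, that is, it is Artinian and its socle is concentrated in one degree. Moreover,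 $A$ has the weak Lefschetz property, that is, there is a linear form $L\in A_1$ such that for every integer $j$ the multiplication map $\times L\colon A_{j-1}\to A_j$ is injective or surjective, if and only if $\det M\not\equiv 0\pmod p$ (for $p=0$ this means $\det M\ne 0$). -/

import Mathlib

open MvPolynomial

noncomputable section

namespace WeakLefschetz

/-- The ideal `(x^(α+t), y^(β+t), z^(γ+t), x^α y^β z^γ)` of `K[x, y, z]`,
with `x = X 0`, `y = X 1`, `z = X 2`. -/
def aciIdeal (K : Type*) [Field K] (α β γ t : ℕ) : Ideal (MvPolynomial (Fin 3) K) :=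
  Ideal.span {X 0 ^ (α + t), X 1 ^ (β + t), X 2 ^ (γ + t), X 0 ^ α * X 1 ^ β * X 2 ^ γ}

/-- The degree `j` component of `K[x_1, …, x_r] / I` (for a homogeneous ideal `I`): the classes of
the homogeneous polynomials of degree `j`. -/
def gradedPiece {σ K : Type*} [Field K] (I : Ideal (MvPolynomial σ K)) (j : ℕ) :
    Submodule K (MvPolynomial σ K ⧸ I) :=
  (homogeneousSubmodule σ K j).map (Ideal.Quotient.mkₐ K I).toLinearMap

/-- The weak Lefschetz property of `K[x_1, …, x_r] / I`: there is a linear form `ℓ` such that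
every multiplication map `A_j → A_(j+1)`, `a ↦ ℓ * a`, is injective or surjective. -/
def HasWLP {σ K : Type*} [Field K] (I : Ideal (MvPolynomial σ K)) : Prop :=
  ∃ ℓ ∈ gradedPiece I 1, ∀ j : ℕ,
    Set.InjOn (fun a => ℓ * a) (gradedPiece I j : Set (MvPolynomial σ K ⧸ I)) ∨
    Set.SurjOn (fun a => ℓ * a) (gradedPiece I j : Set (MvPolynomial σ K ⧸ I))
      (gradedPiece I (j + 1) : Set (MvPolynomial σ K ⧸ I))

/-- `K[x_1, …, x_r] / I` is a level algebra: it is Artinian and its socle (the elements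
annihilated by all elements of positive degree) is concentrated in a single degree. -/
def IsLevel {σ K : Type*} [Field K] (I : Ideal (MvPolynomial σ K)) : Prop :=
  IsArtinianRing (MvPolynomial σ K ⧸ I) ∧
    ∃ e : ℕ, ∀ a : MvPolynomial σ K ⧸ I,
      (∀ j : ℕ, 1 ≤ j → ∀ b ∈ gradedPiece I j, b * a = 0) → a ∈ gradedPiece I e

/-- The binomial coefficient `n` over `k` for an integer `k`; it is `0` when `k < 0`
or `k > n`. -/
def binom (n : ℕ) (k : ℤ) : ℤ := if 0 ≤ k then (n.choose k.toNat : ℤ) else 0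

/-- The size `t + (α + β - 2γ) / 3` of the matrix. -/
def matrixSize (α β γ t : ℕ) : ℕ :=
  ((t : ℤ) + ((α : ℤ) + β - 2 * γ) / 3).toNat

/-- The matrix `M`. With `s = (α + β + γ) / 3` and rows and columns numbered from `0`, the entry in
row `i` and column `j` is `binom γ (s + i - j)` for the first `t - s` rows, and the entry in
row `(t - s) + i'` and column `j` is `binom (γ + t) (t + β - 1 - i' - j)`. -/
def wlpMatrix (α β γ t : ℕ) :
    Matrix (Fin (matrixSize α β γ t)) (Fin (matrixSize α β γ t)) ℤ :=
  Matrix.of fun i j =>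
    let s : ℤ := ((α : ℤ) + β + γ) / 3
    if ((i : ℕ) : ℤ) < (t : ℤ) - s then binom γ (s + ((i : ℕ) : ℤ) - ((j : ℕ) : ℤ))
    else binom (γ + t) ((t : ℤ) + (β : ℤ) - 1 - (((i : ℕ) : ℤ) - ((t : ℤ) - s)) - ((j : ℕ) : ℤ))

end WeakLefschetz

end

/-!
The critical degree is `2 s + t - 1`, where `α + β + γ = 3 s`: there `A` has the same dimension as
in the preceding degree (`card_stdExps_eq`), so the multiplication by a linear form into it is given
by a square matrix in the monomial bases, and injectivity and surjectivity both mean that its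
determinant does not vanish. In the other degrees nothing has to be checked: surjectivity propagates
upwards because `A` is generated in degree one (`surjOn_mul_succ`), and injectivity propagates
downwards because the socle of `A` lies in degree `α + β + γ + 2 t - 3`, above the critical range
(`socle_aciIdeal`, `IsMonomialWith.injOn_mul_of_succ`).

It suffices to consider the linear form `x + y + z`, over every field: the determinant for
`c₀ x + c₁ y + c₂ z` is a monomial in the `cᵢ` times the determinant for `x + y + z`
(`det_sqMulMatrix_sum_X_ne_zero`). No assumption that the `cᵢ` are nonzero, or that the field is
infinite, is needed for this.

For `x + y + z`, a singular matrix means that there is a nonzero functional `φ` on the polynomials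
of critical degree which kills the ideal and the multiples of `x + y + z`
(`det_sqMulMatrix_sum_X_eq_zero_iff`). Eliminating `z = -(x + y)` and setting `y = 1`, such a `φ`
has the form `x^a y^b z^c ↦ lam (X^a (-(X + 1))^c)` for a functional `lam` on `K[X]`. That `φ` kills
the multiples of `x^(α+t)` and `y^(β+t)` says that `lam` is supported on the `n` powers `X^k` with
`2 s - β ≤ k < α + t`; that it kills the multiples of `x^α y^β z^γ` and `z^(γ+t)` gives the upper and
the lower rows of the linear system with the matrix of binomial coefficients
(`exists_functional_iff_det_eq_zero`).
-/

namespace WeakLefschetz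

/-! ### Multiplication by a linear form on a monomial quotient -/

section MonomialIdeal

variable {σ K : Type*} [Field K] {I : Ideal (MvPolynomial σ K)} {U : Set (σ →₀ ℕ)}

/-- `I` is the monomial ideal whose monomials are those with exponent vector in `U`. -/
def IsMonomialWith (I : Ideal (MvPolynomial σ K)) (U : Set (σ →₀ ℕ)) : Prop :=
  ∀ f : MvPolynomial σ K, f ∈ I ↔ ∀ m, m ∉ U → coeff m f = 0

lemma mem_gradedPiece {j : ℕ} {a : MvPolynomial σ K ⧸ I} :
    a ∈ gradedPiece I j ↔ ∃ f : MvPolynomial σ K, f.IsHomogeneous j ∧ Ideal.Quotient.mk I f = a := by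
  simp [gradedPiece, Submodule.mem_map, mem_homogeneousSubmodule]

lemma mk_mem_gradedPiece {j : ℕ} {f : MvPolynomial σ K} (hf : f.IsHomogeneous j) :
    Ideal.Quotient.mk I f ∈ gradedPiece I j :=
  mem_gradedPiece.2 ⟨f, hf, rfl⟩

lemma mul_mem_gradedPiece {i j : ℕ} {a b : MvPolynomial σ K ⧸ I} (ha : a ∈ gradedPiece I i)
    (hb : b ∈ gradedPiece I j) : a * b ∈ gradedPiece I (i + j) := by
  obtain ⟨f, hf, rfl⟩ := mem_gradedPiece.1 ha
  obtain ⟨g, hg, rfl⟩ := mem_gradedPiece.1 hb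
  exact mem_gradedPiece.2 ⟨f * g, hf.mul hg, by simp⟩

/-- The graded pieces of a monomial quotient meet trivially. -/
lemma IsMonomialWith.eq_zero_of_mem_of_mem (hI : IsMonomialWith I U) {i j : ℕ} (hij : i ≠ j)
    {a : MvPolynomial σ K ⧸ I} (hi : a ∈ gradedPiece I i) (hj : a ∈ gradedPiece I j) : a = 0 := by
  obtain ⟨f, hf, rfl⟩ := mem_gradedPiece.1 hi
  obtain ⟨g, hg, hfg⟩ := mem_gradedPiece.1 hj
  rw [Ideal.Quotient.eq, hI] at hfg
  rw [Ideal.Quotient.eq_zero_iff_mem, hI]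
  intro m hm
  by_cases h : m.degree = i
  · have := hfg m hm
    rwa [coeff_sub, hg.coeff_eq_zero (by omega), zero_sub, neg_eq_zero] at this
  · exact hf.coeff_eq_zero h

lemma injOn_mul_iff {j : ℕ} (ℓ : MvPolynomial σ K ⧸ I) :
    Set.InjOn (fun a => ℓ * a) (gradedPiece I j : Set (MvPolynomial σ K ⧸ I)) ↔
      ∀ a ∈ gradedPiece I j, ℓ * a = 0 → a = 0 := by
  constructor
  · intro h a ha h0
    exact h ha (Submodule.zero_mem _) (by simpa using h0)
  · intro h a ha b hb hab
    exact sub_eq_zero.1 (h _ (Submodule.sub_mem _ ha hb) (by rw [mul_sub]; exact sub_eq_zero.2 hab))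

/-- Surjectivity of the multiplication by `ℓ` propagates upwards, because the algebra is
generated in degree one. -/
lemma surjOn_mul_succ {j : ℕ} {ℓ : MvPolynomial σ K ⧸ I}
    (h : Set.SurjOn (fun a => ℓ * a) (gradedPiece I j : Set (MvPolynomial σ K ⧸ I))
      (gradedPiece I (j + 1) : Set (MvPolynomial σ K ⧸ I))) :
    Set.SurjOn (fun a => ℓ * a) (gradedPiece I (j + 1) : Set (MvPolynomial σ K ⧸ I))
      (gradedPiece I (j + 1 + 1) : Set (MvPolynomial σ K ⧸ I)) := by
  -- The image is a subspace, so monomials suffice.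
  let T : Submodule K (MvPolynomial σ K) :=
    ((gradedPiece I (j + 1)).map (LinearMap.mulLeft K ℓ)).comap (Ideal.Quotient.mkₐ K I).toLinearMap
  have key : homogeneousSubmodule σ K (j + 1 + 1) ≤ T := by
    intro f hf
    rw [mem_homogeneousSubmodule] at hf
    rw [f.as_sum]
    refine Submodule.sum_mem _ fun m hm => ?_
    have hdeg : m.degree = j + 1 + 1 := by
      by_contra hne
      exact (mem_support_iff.1 hm) (hf.coeff_eq_zero hne)
    have hm0 : m ≠ 0 := by rintro rfl; simp at hdeg
    obtain ⟨i, hi⟩ := Finsupp.ne_iff.1 hm0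
    have hle : Finsupp.single i 1 ≤ m := by
      rw [Finsupp.single_le_iff]; simp at hi; omega
    obtain ⟨m', rfl⟩ := exists_add_of_le hle
    have hdeg' : m'.degree = j + 1 := by
      simp [map_add] at hdeg; omega
    obtain ⟨a, ha, hab⟩ := h (mk_mem_gradedPiece (I := I)
      (isHomogeneous_monomial (coeff (Finsupp.single i 1 + m') f) hdeg'))
    refine Submodule.mem_map.2 ⟨Ideal.Quotient.mk I (X i) * a, ?_, ?_⟩
    · have := mul_mem_gradedPiece (mk_mem_gradedPiece (I := I) (isHomogeneous_X K i)) ha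
      rwa [add_comm] at this
    · have hab' : ℓ * a = _ := hab
      have : (monomial (Finsupp.single i 1 + m') (coeff (Finsupp.single i 1 + m') f)) =
          X i * monomial m' (coeff (Finsupp.single i 1 + m') f) := by
        simp [X, monomial_mul]
      rw [this]
      simp only [LinearMap.mulLeft_apply, AlgHom.toLinearMap_apply, map_mul,
        Ideal.Quotient.mkₐ_eq_mk]
      rw [← hab']
      ring
  intro b hb
  obtain ⟨f, hf, rfl⟩ := mem_gradedPiece.1 hb
  obtain ⟨a, ha, hab⟩ := Submodule.mem_map.1 (key ((mem_homogeneousSubmodule _ _).2 hf))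
  exact ⟨a, ha, hab⟩

/-- If the socle lies in degree `e`, injectivity of the multiplication by `ℓ` propagates from
degree `j + 1` to degree `j`, provided `j ≠ e`. -/
lemma IsMonomialWith.injOn_mul_of_succ (hI : IsMonomialWith I U) {e j : ℕ}
    (he : ∀ a : MvPolynomial σ K ⧸ I,
      (∀ i, Ideal.Quotient.mk I (X i) * a = 0) → a ∈ gradedPiece I e)
    (hj : j ≠ e) {ℓ : MvPolynomial σ K ⧸ I}
    (h : Set.InjOn (fun a => ℓ * a) (gradedPiece I (j + 1) : Set (MvPolynomial σ K ⧸ I))) :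
    Set.InjOn (fun a => ℓ * a) (gradedPiece I j : Set (MvPolynomial σ K ⧸ I)) := by
  rw [injOn_mul_iff] at h ⊢
  intro a ha h0
  refine hI.eq_zero_of_mem_of_mem hj ha (he a fun i => h _ ?_ ?_)
  · have := mul_mem_gradedPiece (mk_mem_gradedPiece (I := I) (isHomogeneous_X K i)) ha
    rwa [add_comm] at this
  · rw [mul_left_comm, h0, mul_zero]

/-! ### The matrix of a multiplication in the monomial bases -/

variable [Fintype σ] [DecidableEq σ]

open Classical in
/-- The exponent vectors of the monomials of degree `j` outside a monomial ideal with exponent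
set `U`; they index a basis of the degree `j` component of the quotient. -/
noncomputable def stdExps (U : Set (σ →₀ ℕ)) (j : ℕ) : Finset (σ →₀ ℕ) :=
  (Finset.univ.finsuppAntidiag j).filter (· ∉ U)

lemma mem_stdExps {j : ℕ} {m : σ →₀ ℕ} : m ∈ stdExps U j ↔ m.degree = j ∧ m ∉ U := by
  simp [stdExps, Finset.mem_finsuppAntidiag, Finsupp.degree_eq_sum]

/-- The matrix, in the monomial bases, of the multiplication by `L` from degree `i` to
degree `j`. -/
noncomputable def mulMatrix (U : Set (σ →₀ ℕ)) (i j : ℕ) (L : MvPolynomial σ K) :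
    Matrix (stdExps U j) (stdExps U i) K :=
  Matrix.of fun m' m => coeff (m' : σ →₀ ℕ) (L * monomial (m : σ →₀ ℕ) 1)

/-- The polynomial with given coordinates with respect to the standard monomials of
degree `j`. -/
noncomputable def ofCoords (U : Set (σ →₀ ℕ)) (j : ℕ) (v : stdExps U j → K) : MvPolynomial σ K :=
  ∑ m : stdExps U j, monomial (m : σ →₀ ℕ) (v m)

lemma isHomogeneous_ofCoords {j : ℕ} (v : stdExps U j → K) : (ofCoords U j v).IsHomogeneous j :=
  IsHomogeneous.sum _ _ _ fun m _ => isHomogeneous_monomial _ (mem_stdExps.1 m.2).1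

lemma coeff_ofCoords {j : ℕ} (v : stdExps U j → K) (m : stdExps U j) :
    coeff (m : σ →₀ ℕ) (ofCoords U j v) = v m := by
  simp [ofCoords, coeff_sum, coeff_monomial]

lemma coeff_mul_ofCoords {i j : ℕ} (L : MvPolynomial σ K) (v : stdExps U i → K)
    (m' : stdExps U j) :
    coeff (m' : σ →₀ ℕ) (L * ofCoords U i v) = ((mulMatrix U i j L).mulVec v) m' := by
  simp only [ofCoords, Finset.mul_sum, coeff_sum, Matrix.mulVec, dotProduct, mulMatrix,
    Matrix.of_apply]
  refine Finset.sum_congr rfl fun m _ => ?_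
  simp [coeff_mul_monomial']

lemma IsMonomialWith.mem_iff_of_isHomogeneous (hI : IsMonomialWith I U) {j : ℕ}
    {f : MvPolynomial σ K} (hf : f.IsHomogeneous j) :
    f ∈ I ↔ ∀ m : stdExps U j, coeff (m : σ →₀ ℕ) f = 0 := by
  rw [hI]
  constructor
  · intro h m
    exact h m (mem_stdExps.1 m.2).2
  · intro h m hm
    by_cases hd : m.degree = j
    · exact h ⟨m, mem_stdExps.2 ⟨hd, hm⟩⟩
    · exact hf.coeff_eq_zero hd

/-- Every class of degree `j` has a representative spanned by the standard monomials. -/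
lemma IsMonomialWith.exists_ofCoords (hI : IsMonomialWith I U) {j : ℕ}
    {a : MvPolynomial σ K ⧸ I} (ha : a ∈ gradedPiece I j) :
    ∃ v, Ideal.Quotient.mk I (ofCoords U j v) = a := by
  obtain ⟨f, hf, rfl⟩ := mem_gradedPiece.1 ha
  refine ⟨fun m => coeff (m : σ →₀ ℕ) f, ?_⟩
  rw [Ideal.Quotient.eq, hI.mem_iff_of_isHomogeneous ((isHomogeneous_ofCoords _).sub hf)]
  intro m
  rw [coeff_sub, coeff_ofCoords, sub_self]

lemma IsMonomialWith.injOn_mul_iff_mulVec (hI : IsMonomialWith I U) {j : ℕ}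
    {L : MvPolynomial σ K} (hL : L.IsHomogeneous 1) :
    Set.InjOn (fun a => Ideal.Quotient.mk I L * a)
        (gradedPiece I j : Set (MvPolynomial σ K ⧸ I)) ↔
      Function.Injective (mulMatrix U j (j + 1) L).mulVec := by
  rw [injOn_mul_iff, ← Matrix.coe_mulVecLin, ← LinearMap.ker_eq_bot, LinearMap.ker_eq_bot']
  simp only [Matrix.mulVecLin_apply]
  have hmul : ∀ v, Ideal.Quotient.mk I L * Ideal.Quotient.mk I (ofCoords U j v) = 0 ↔
      (mulMatrix U j (j + 1) L).mulVec v = 0 := by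
    intro v
    rw [← map_mul, Ideal.Quotient.eq_zero_iff_mem, hI.mem_iff_of_isHomogeneous
      (by simpa [add_comm] using hL.mul (isHomogeneous_ofCoords v)), funext_iff]
    simp only [coeff_mul_ofCoords, Pi.zero_apply]
  have hzero : ∀ v, Ideal.Quotient.mk I (ofCoords U j v) = 0 ↔ v = 0 := by
    intro v
    rw [Ideal.Quotient.eq_zero_iff_mem, hI.mem_iff_of_isHomogeneous (isHomogeneous_ofCoords v),
      funext_iff]
    simp only [coeff_ofCoords, Pi.zero_apply]
  constructor
  · intro h v hv
    exact (hzero v).1 (h _ (mk_mem_gradedPiece (isHomogeneous_ofCoords v)) ((hmul v).2 hv))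
  · intro h a ha h0
    obtain ⟨v, rfl⟩ := hI.exists_ofCoords ha
    exact (hzero v).2 (h v ((hmul v).1 h0))

lemma IsMonomialWith.surjOn_mul_iff_mulVec (hI : IsMonomialWith I U) {j : ℕ}
    {L : MvPolynomial σ K} (hL : L.IsHomogeneous 1) :
    Set.SurjOn (fun a => Ideal.Quotient.mk I L * a)
        (gradedPiece I j : Set (MvPolynomial σ K ⧸ I))
        (gradedPiece I (j + 1) : Set (MvPolynomial σ K ⧸ I)) ↔
      Function.Surjective (mulMatrix U j (j + 1) L).mulVec := by
  have hmul : ∀ v w, Ideal.Quotient.mk I L * Ideal.Quotient.mk I (ofCoords U j v) =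
      Ideal.Quotient.mk I (ofCoords U (j + 1) w) ↔ (mulMatrix U j (j + 1) L).mulVec v = w := by
    intro v w
    rw [← map_mul, Ideal.Quotient.eq, hI.mem_iff_of_isHomogeneous (j := j + 1)
      ((by simpa [add_comm] using hL.mul (isHomogeneous_ofCoords v) :
        (L * ofCoords U j v).IsHomogeneous (j + 1)).sub (isHomogeneous_ofCoords w)), funext_iff]
    simp only [coeff_sub, coeff_mul_ofCoords, coeff_ofCoords, sub_eq_zero]
  constructor
  · intro h w
    obtain ⟨a, ha, hw⟩ := h (mk_mem_gradedPiece (isHomogeneous_ofCoords w))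
    obtain ⟨v, rfl⟩ := hI.exists_ofCoords ha
    exact ⟨v, (hmul v w).1 hw⟩
  · intro h b hb
    obtain ⟨w, rfl⟩ := hI.exists_ofCoords hb
    obtain ⟨v, hv⟩ := h w
    exact ⟨_, mk_mem_gradedPiece (isHomogeneous_ofCoords v), (hmul v w).2 hv⟩

/-- The matrix of the multiplication by `L`, made square by an identification of the two
monomial bases. -/
noncomputable def sqMulMatrix {i j : ℕ} (e : stdExps U i ≃ stdExps U j) (L : MvPolynomial σ K) :
    Matrix (stdExps U i) (stdExps U i) K :=
  (mulMatrix U i j L).submatrix e id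

lemma IsMonomialWith.injOn_iff_det_ne_zero (hI : IsMonomialWith I U) {j : ℕ}
    (e : stdExps U j ≃ stdExps U (j + 1)) {L : MvPolynomial σ K} (hL : L.IsHomogeneous 1) :
    Set.InjOn (fun a => Ideal.Quotient.mk I L * a)
        (gradedPiece I j : Set (MvPolynomial σ K ⧸ I)) ↔ (sqMulMatrix e L).det ≠ 0 := by
  rw [hI.injOn_mul_iff_mulVec hL, ← isUnit_iff_ne_zero, ← Matrix.isUnit_iff_isUnit_det,
    ← Matrix.mulVec_injective_iff_isUnit]
  exact (Function.Injective.of_comp_iff (e.surjective.injective_comp_right) _).symm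

lemma IsMonomialWith.surjOn_iff_det_ne_zero (hI : IsMonomialWith I U) {j : ℕ}
    (e : stdExps U j ≃ stdExps U (j + 1)) {L : MvPolynomial σ K} (hL : L.IsHomogeneous 1) :
    Set.SurjOn (fun a => Ideal.Quotient.mk I L * a)
        (gradedPiece I j : Set (MvPolynomial σ K ⧸ I))
        (gradedPiece I (j + 1) : Set (MvPolynomial σ K ⧸ I)) ↔ (sqMulMatrix e L).det ≠ 0 := by
  rw [hI.surjOn_mul_iff_mulVec hL, ← isUnit_iff_ne_zero, ← Matrix.isUnit_iff_isUnit_det,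
    ← Matrix.mulVec_surjective_iff_isUnit]
  have hb : Function.Bijective (fun f : stdExps U (j + 1) → K => f ∘ e) :=
    (e.symm.arrowCongr (Equiv.refl K)).bijective
  exact (Function.Surjective.of_comp_iff' hb _).symm

/-- A general linear form may be replaced by the sum of the variables. The only nonzero entries of
the matrix of `L` are the coefficients `c i` of `L`, at `m' = m + e_i`, so all nonzero terms of the
Leibniz expansion carry the same monomial in the `c i`: the exponent of `c i` is determined by the
sum of all row indices and the sum of all column indices. Hence `det` for `L` is this monomial times
`det` for the sum of the variables. -/
lemma det_sqMulMatrix_sum_X_ne_zero {j : ℕ} (e : stdExps U j ≃ stdExps U (j + 1))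
    {L : MvPolynomial σ K} (hL : (sqMulMatrix e L).det ≠ 0) :
    (sqMulMatrix e (∑ i, X i : MvPolynomial σ K)).det ≠ 0 := by
  set c : σ → K := fun i => coeff (Finsupp.single i 1) L with hc
  have hentry : ∀ (m' : stdExps U (j + 1)) (m : stdExps U j),
      mulMatrix U j (j + 1) L m' m = (∏ i, c i ^ ((m' : σ →₀ ℕ) i - (m : σ →₀ ℕ) i)) *
        mulMatrix U j (j + 1) (∑ i, X i : MvPolynomial σ K) m' m := by
    rintro ⟨m', hm'⟩ ⟨m, hm⟩
    simp only [mulMatrix, Matrix.of_apply, coeff_mul_monomial', mul_one]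
    split_ifs with hle
    · obtain ⟨d, rfl⟩ := exists_add_of_le hle
      have hd : d.degree = 1 := by
        have h1 := (mem_stdExps.1 hm').1
        have h2 := (mem_stdExps.1 hm).1
        rw [map_add] at h1
        omega
      obtain ⟨i, rfl⟩ : ∃ i, d = Finsupp.single i 1 := by
        have hd0 : d ≠ 0 := by rintro rfl; simp at hd
        obtain ⟨i, hi⟩ := Finsupp.ne_iff.1 hd0
        have hle : Finsupp.single i 1 ≤ d := by
          rw [Finsupp.single_le_iff]; simp at hi; omega
        obtain ⟨d', rfl⟩ := exists_add_of_le hle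
        have : d' = 0 := by
          rw [← Finsupp.degree_eq_zero_iff]
          simp at hd; simpa using hd
        exact ⟨i, by simp [this]⟩
      simp [coeff_sum, coeff_X, Finsupp.single_apply, pow_ite, Finsupp.single_left_inj, hc]
    · simp
  have hterm : ∀ τ : Equiv.Perm (stdExps U j),
      ∏ m, sqMulMatrix e L (τ m) m =
        (∏ i, c i ^ (∑ m : stdExps U j, (e m : σ →₀ ℕ) i - ∑ m : stdExps U j, (m : σ →₀ ℕ) i)) *
          ∏ m, sqMulMatrix e (∑ i, X i : MvPolynomial σ K) (τ m) m := by
    intro τ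
    simp only [sqMulMatrix, Matrix.submatrix_apply, id, hentry, Finset.prod_mul_distrib]
    by_cases h0 : ∏ m, mulMatrix U j (j + 1) (∑ i, X i : MvPolynomial σ K) (e (τ m)) m = 0
    · rw [h0, mul_zero, mul_zero]
    congr 1
    have hle : ∀ m : stdExps U j, (m : σ →₀ ℕ) ≤ e (τ m) := by
      intro m
      have := (Finset.prod_ne_zero_iff.1 h0) m (Finset.mem_univ _)
      simp only [mulMatrix, Matrix.of_apply, coeff_mul_monomial'] at this
      by_contra hn
      exact this (if_neg hn)
    rw [Finset.prod_comm]
    refine Finset.prod_congr rfl fun i _ => ?_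
    rw [Finset.prod_pow_eq_pow_sum, Finset.sum_tsub_distrib _ fun m _ => hle m i,
      Equiv.sum_comp τ fun m => (e m : σ →₀ ℕ) i]
  intro h0
  refine hL ?_
  have : (sqMulMatrix e L).det =
      (∏ i, c i ^ (∑ m : stdExps U j, (e m : σ →₀ ℕ) i - ∑ m : stdExps U j, (m : σ →₀ ℕ) i)) *
        (sqMulMatrix e (∑ i, X i : MvPolynomial σ K)).det := by
    rw [Matrix.det_apply, Matrix.det_apply, Finset.mul_sum]
    refine Finset.sum_congr rfl fun τ _ => ?_
    rw [hterm, mul_smul_comm]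
  rw [this, h0, mul_zero]

/-- The inverse system: the matrix of the multiplication by the sum of the variables is singular
iff some nonzero functional on degree `j + 1` kills the ideal and all multiples of that sum.
Functionals are given by their values `φ m` on the monomials. -/
lemma det_sqMulMatrix_sum_X_eq_zero_iff (hU : ∀ m ∈ U, ∀ i, m + Finsupp.single i 1 ∈ U) {j : ℕ}
    (e : stdExps U j ≃ stdExps U (j + 1)) :
    (sqMulMatrix e (∑ i, X i : MvPolynomial σ K)).det = 0 ↔
      ∃ φ : (σ →₀ ℕ) → K, (∃ m, m.degree = j + 1 ∧ φ m ≠ 0) ∧ (∀ m ∈ U, φ m = 0) ∧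
        ∀ m, m.degree = j → ∑ i, φ (m + Finsupp.single i 1) = 0 := by
  have hsum : ∀ (φ : (σ →₀ ℕ) → K), (∀ m ∈ U, φ m = 0) → ∀ m : stdExps U j,
      Matrix.vecMul (fun m => φ (e m : σ →₀ ℕ)) (sqMulMatrix e (∑ i, X i : MvPolynomial σ K)) m =
        ∑ i, φ ((m : σ →₀ ℕ) + Finsupp.single i 1) := by
    intro φ hφ m
    simp only [Matrix.vecMul, dotProduct, sqMulMatrix, Matrix.submatrix_apply, id, mulMatrix,
      Matrix.of_apply]
    rw [Equiv.sum_comp e fun m' : stdExps U (j + 1) => φ (m' : σ →₀ ℕ) *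
      coeff (m' : σ →₀ ℕ) ((∑ i, X i : MvPolynomial σ K) * monomial (m : σ →₀ ℕ) 1)]
    simp only [Finset.sum_mul, coeff_sum, Finset.mul_sum]
    rw [Finset.sum_comm]
    refine Finset.sum_congr rfl fun i _ => ?_
    have hX : ∀ m' : σ →₀ ℕ, coeff m' (X i * monomial (m : σ →₀ ℕ) (1 : K)) =
        if (m : σ →₀ ℕ) + Finsupp.single i 1 = m' then 1 else 0 := by
      intro m'
      rw [X, monomial_mul, coeff_monomial, add_comm, mul_one]
    simp only [hX, mul_ite, mul_one, mul_zero]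
    by_cases hm : (m : σ →₀ ℕ) + Finsupp.single i 1 ∈ stdExps U (j + 1)
    · rw [Finset.sum_eq_single ⟨_, hm⟩]
      · simp
      · intro b _ hb
        exact if_neg fun h => hb (Subtype.ext h.symm)
      · simp
    · rw [Finset.sum_eq_zero, hφ]
      · by_contra hn
        exact hm (mem_stdExps.2 ⟨by simp [(mem_stdExps.1 m.2).1], hn⟩)
      · intro b _
        refine if_neg fun h => hm ?_
        rw [h]
        exact b.2
  rw [← Matrix.exists_vecMul_eq_zero_iff]
  constructor
  · rintro ⟨w, hw, h0⟩
    let φ : (σ →₀ ℕ) → K := fun m => if hm : m ∈ stdExps U (j + 1) then w (e.symm ⟨m, hm⟩) else 0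
    have hφe : (fun m => φ (e m : σ →₀ ℕ)) = w := by
      funext m
      simp [φ]
    have hφU : ∀ m ∈ U, φ m = 0 := fun m hm => dif_neg fun h => (mem_stdExps.1 h).2 hm
    refine ⟨φ, ?_, hφU, fun m hm => ?_⟩
    · obtain ⟨m, hm⟩ := Function.ne_iff.1 hw
      exact ⟨e m, (mem_stdExps.1 (e m).2).1, by rw [congrFun hφe m]; exact hm⟩
    · by_cases hmU : m ∈ U
      · exact Finset.sum_eq_zero fun i _ => hφU _ (hU m hmU i)
      · rw [← hsum φ hφU ⟨m, mem_stdExps.2 ⟨hm, hmU⟩⟩, hφe, h0, Pi.zero_apply]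
  · rintro ⟨φ, ⟨m, hm, hne⟩, hφU, hφ⟩
    refine ⟨fun m => φ (e m : σ →₀ ℕ), fun h => hne ?_, ?_⟩
    · have hmU : m ∉ U := fun h => hne (hφU m h)
      have := congrFun h (e.symm ⟨m, mem_stdExps.2 ⟨hm, hmU⟩⟩)
      simpa using this
    · funext m
      rw [hsum φ hφU, hφ _ (mem_stdExps.1 m.2).1, Pi.zero_apply]

end MonomialIdeal

/-! ### The almost complete intersection -/

section Aci

variable (K : Type*) [Field K] (α β γ t : ℕ)

/-- The exponent vectors of the monomials in `aciIdeal K α β γ t`. -/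
def aciExps : Set (Fin 3 →₀ ℕ) :=
  {m | α + t ≤ m 0 ∨ β + t ≤ m 1 ∨ γ + t ≤ m 2 ∨ (α ≤ m 0 ∧ β ≤ m 1 ∧ γ ≤ m 2)}

variable {α β γ t}

lemma mem_aciExps {m : Fin 3 →₀ ℕ} : m ∈ aciExps α β γ t ↔
    α + t ≤ m 0 ∨ β + t ≤ m 1 ∨ γ + t ≤ m 2 ∨ (α ≤ m 0 ∧ β ≤ m 1 ∧ γ ≤ m 2) := Iff.rfl

lemma degree_fin_three (m : Fin 3 →₀ ℕ) : m.degree = m 0 + m 1 + m 2 := by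
  rw [Finsupp.degree_eq_sum, Fin.sum_univ_three]

lemma aciExps_add_single {m : Fin 3 →₀ ℕ} (hm : m ∈ aciExps α β γ t) (i : Fin 3) :
    m + Finsupp.single i 1 ∈ aciExps α β γ t := by
  rw [mem_aciExps] at hm ⊢
  simp only [Finsupp.add_apply]
  omega

variable (α β γ t) in
lemma isMonomialWith_aciIdeal : IsMonomialWith (aciIdeal K α β γ t) (aciExps α β γ t) := by
  intro f
  have h : aciIdeal K α β γ t = Ideal.span ((fun m => monomial m (1 : K)) ''
      {Finsupp.single 0 (α + t), Finsupp.single 1 (β + t), Finsupp.single 2 (γ + t),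
        Finsupp.single 0 α + Finsupp.single 1 β + Finsupp.single 2 γ}) := by
    simp only [aciIdeal, Set.image_insert_eq, Set.image_singleton, X_pow_eq_monomial,
      monomial_mul, mul_one]
  rw [h, mem_ideal_span_monomial_image]
  have hle : ∀ m : Fin 3 →₀ ℕ, (∃ s ∈ ({Finsupp.single 0 (α + t), Finsupp.single 1 (β + t),
      Finsupp.single 2 (γ + t), Finsupp.single 0 α + Finsupp.single 1 β + Finsupp.single 2 γ} :
        Set (Fin 3 →₀ ℕ)), s ≤ m) ↔ m ∈ aciExps α β γ t := by
    intro m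
    simp [mem_aciExps, Finsupp.le_def, Fin.forall_fin_succ]
  simp only [hle, mem_support_iff]
  exact forall_congr' fun m => not_imp_comm

lemma isArtinianRing_aciIdeal : IsArtinianRing (MvPolynomial (Fin 3) K ⧸ aciIdeal K α β γ t) := by
  set I := aciIdeal K α β γ t
  have hX : ∀ i : Fin 3, ∃ n, (X i : MvPolynomial (Fin 3) K) ^ n ∈ I := by
    intro i
    fin_cases i
    · exact ⟨α + t, Ideal.subset_span (by simp)⟩
    · exact ⟨β + t, Ideal.subset_span (by simp)⟩
    · exact ⟨γ + t, Ideal.subset_span (by simp)⟩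
  have hint : ∀ f : MvPolynomial (Fin 3) K, Ideal.Quotient.mkₐ K I f ∈
      integralClosure K (MvPolynomial (Fin 3) K ⧸ I) := by
    intro f
    have : (⊤ : Subalgebra K (MvPolynomial (Fin 3) K)) ≤
        (integralClosure K (MvPolynomial (Fin 3) K ⧸ I)).comap (Ideal.Quotient.mkₐ K I) := by
      rw [← adjoin_range_X, Algebra.adjoin_le_iff]
      rintro _ ⟨i, rfl⟩
      obtain ⟨n, hn⟩ := hX i
      have h0 : (Ideal.Quotient.mkₐ K I (X i)) ^ (n + 1) = 0 := by
        rw [← map_pow, Ideal.Quotient.mkₐ_eq_mk, Ideal.Quotient.eq_zero_iff_mem, pow_succ]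
        exact I.mul_mem_right _ hn
      have h1 : IsIntegral K ((Ideal.Quotient.mkₐ K I (X i)) ^ (n + 1)) := by
        rw [h0]
        exact isIntegral_zero
      exact IsIntegral.of_pow n.succ_pos h1
    exact this Algebra.mem_top
  have : Algebra.IsIntegral K (MvPolynomial (Fin 3) K ⧸ I) := ⟨fun a => by
    obtain ⟨f, rfl⟩ := Ideal.Quotient.mk_surjective a
    exact hint f⟩
  have : Module.Finite K (MvPolynomial (Fin 3) K ⧸ I) := Algebra.IsIntegral.finite
  exact IsArtinianRing.of_finite K _

/-- A standard monomial all of whose multiples by variables lie in the ideal is one of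
`x^(α-1) y^(β+t-1) z^(γ+t-1)`, `x^(α+t-1) y^(β-1) z^(γ+t-1)`, `x^(α+t-1) y^(β+t-1) z^(γ-1)`. -/
lemma socle_aciIdeal (ht : 0 < t) (a : MvPolynomial (Fin 3) K ⧸ aciIdeal K α β γ t)
    (ha : ∀ i, Ideal.Quotient.mk _ (X i) * a = 0) :
    a ∈ gradedPiece (aciIdeal K α β γ t) (α + β + γ + 2 * t - 3) := by
  have hI := isMonomialWith_aciIdeal K α β γ t
  obtain ⟨f, rfl⟩ := Ideal.Quotient.mk_surjective a
  refine mem_gradedPiece.2 ⟨homogeneousComponent (α + β + γ + 2 * t - 3) f,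
    homogeneousComponent_isHomogeneous _ _, ?_⟩
  rw [Ideal.Quotient.eq, hI]
  intro m hm
  rw [coeff_sub, coeff_homogeneousComponent]
  split_ifs with hd
  · exact sub_self _
  rw [zero_sub, neg_eq_zero]
  by_contra hne
  have hmem : ∀ i, m + Finsupp.single i 1 ∈ aciExps α β γ t := by
    intro i
    have := ha i
    rw [← map_mul, Ideal.Quotient.eq_zero_iff_mem, hI] at this
    by_contra hn
    have := this _ hn
    rw [add_comm, coeff_X_mul] at this
    exact hne this
  have h0 := hmem 0
  have h1 := hmem 1
  have h2 := hmem 2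
  rw [degree_fin_three] at hd
  rw [mem_aciExps] at h0 h1 h2 hm
  simp at h0 h1 h2
  omega

lemma isLevel_aciIdeal (ht : 0 < t) : IsLevel (aciIdeal K α β γ t) :=
  ⟨isArtinianRing_aciIdeal K, _, fun a ha => socle_aciIdeal K ht a fun i =>
    ha 1 le_rfl _ (mk_mem_gradedPiece (isHomogeneous_X K i))⟩

end Aci

/-! ### The critical degree -/

/-- The exponent vector `(a, b, c)`. -/
noncomputable def expVec (a b c : ℕ) : Fin 3 →₀ ℕ := Finsupp.equivFunOnFinite.symm ![a, b, c]

@[simp] lemma expVec_zero (a b c : ℕ) : expVec a b c 0 = a := rfl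
@[simp] lemma expVec_one (a b c : ℕ) : expVec a b c 1 = b := rfl
@[simp] lemma expVec_two (a b c : ℕ) : expVec a b c 2 = c := rfl

lemma exp_ext {m m' : Fin 3 →₀ ℕ} (h0 : m 0 = m' 0) (h1 : m 1 = m' 1) (h2 : m 2 = m' 2) :
    m = m' := by
  ext i
  fin_cases i <;> assumption

/-- In the critical degree `2 s + t - 1`, where `α + β + γ = 3 s`, the algebra has the same
dimension as in the preceding degree. Multiplication by `z` matches the standard monomials of the
lower degree that stay standard with those of the upper degree divisible by `z`. What is left are
the monomials `x^a y^b` above, and below the monomials with `z`-exponent `γ + t - 1`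
(there are `2 s - γ` of them) or `γ - 1` (there are `t - s` of them). -/
lemma card_stdExps_eq {α β γ t s : ℕ} (hs : α + β + γ = 3 * s) (hα : 0 < α) (hαβ : α ≤ β)
    (hβγ : β ≤ γ) (hγ : γ ≤ 2 * s) (ht : s ≤ t) :
    (stdExps (aciExps α β γ t) (2 * s + t - 2)).card =
      (stdExps (aciExps α β γ t) (2 * s + t - 2 + 1)).card := by
  classical
  let F : (Fin 3 →₀ ℕ) → (Fin 3 →₀ ℕ) := fun m =>
    if expVec (m 0) (m 1) (m 2 + 1) ∉ aciExps α β γ t then expVec (m 0) (m 1) (m 2 + 1)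
    else if m 2 + 1 = γ + t then
      expVec (m 0 + (2 * s - β)) (2 * s + t - 1 - (m 0 + (2 * s - β))) 0
    else expVec (m 0 + (4 * s - β - γ - α)) (2 * s + t - 1 - (m 0 + (4 * s - β - γ - α))) 0
  let G : (Fin 3 →₀ ℕ) → (Fin 3 →₀ ℕ) := fun m =>
    if m 2 ≠ 0 then expVec (m 0) (m 1) (m 2 - 1)
    else if m 0 < 4 * s - β - γ then
      expVec (m 0 - (2 * s - β)) (2 * s - 1 - γ - (m 0 - (2 * s - β))) (γ + t - 1)
    else expVec (m 0 - (4 * s - β - γ - α))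
      (2 * s + t - 1 - γ - (m 0 - (4 * s - β - γ - α))) (γ - 1)
  refine Finset.card_nbij' F G ?_ ?_ ?_ ?_
  · intro m hm
    simp only [Finset.mem_coe, mem_stdExps, degree_fin_three, mem_aciExps] at hm ⊢
    simp only [F, mem_aciExps]
    split_ifs with h1 h2 <;> simp only [expVec_zero, expVec_one, expVec_two] at * <;> omega
  · intro m hm
    simp only [Finset.mem_coe, mem_stdExps, degree_fin_three, mem_aciExps] at hm ⊢
    simp only [G]
    split_ifs with h1 h2 <;> simp only [expVec_zero, expVec_one, expVec_two] at * <;> omega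
  · intro m hm
    simp only [Finset.mem_coe, mem_stdExps, degree_fin_three, mem_aciExps] at hm
    simp only [F, G, mem_aciExps]
    split_ifs <;> simp only [expVec_zero, expVec_one, expVec_two] at * <;>
      first | omega | (apply exp_ext <;> simp only [expVec_zero, expVec_one, expVec_two] <;> omega)
  · intro m hm
    simp only [Finset.mem_coe, mem_stdExps, degree_fin_three, mem_aciExps] at hm
    simp only [F, G, mem_aciExps]
    split_ifs <;> simp only [expVec_zero, expVec_one, expVec_two] at * <;>
      first | omega | (apply exp_ext <;> simp only [expVec_zero, expVec_one, expVec_two] <;> omega)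

/-! ### Functionals on the critical degree and the matrix of binomial coefficients -/

section Binomial

variable {K : Type*} [Field K]

/-- The linear functional on `K[X]` with value `u j` at `X ^ (r + j)` for `j < n` and zero at all
other powers of `X`. -/
noncomputable def windowFunctional (r : ℕ) {n : ℕ} (u : Fin n → K) : Polynomial K →ₗ[K] K :=
  ∑ j : Fin n, u j • Polynomial.lcoeff K (r + j)

lemma windowFunctional_apply (r : ℕ) {n : ℕ} (u : Fin n → K) (q : Polynomial K) :
    windowFunctional r u q = ∑ j : Fin n, u j * q.coeff (r + j) := by
  simp [windowFunctional, LinearMap.sum_apply]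

/-- The image of `x^a y^b z^c` under `x ↦ X`, `y ↦ 1`, `z ↦ -(X + 1)`, which kills
`x + y + z`. -/
noncomputable def elimPoly (a c : ℕ) : Polynomial K :=
  Polynomial.X ^ a * (-(Polynomial.X + 1)) ^ c

lemma elimPoly_relation (a c : ℕ) :
    (elimPoly (a + 1) c + elimPoly a c + elimPoly a (c + 1) : Polynomial K) = 0 := by
  simp only [elimPoly]
  ring

lemma coeff_elimPoly (a c k : ℕ) :
    (elimPoly a c : Polynomial K).coeff k =
      if a ≤ k then (-1) ^ c * (c.choose (k - a) : K) else 0 := by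
  have : (elimPoly a c : Polynomial K) =
      Polynomial.X ^ a * (Polynomial.C ((-1) ^ c) * (Polynomial.X + 1) ^ c) := by
    rw [elimPoly, neg_pow]
    simp
  rw [this, Polynomial.coeff_X_pow_mul', Polynomial.coeff_C_mul, Polynomial.coeff_X_add_one_pow]

lemma binom_add (c k m : ℕ) (h : k + m = c) : binom c k = c.choose m := by
  rw [binom, if_pos (Int.natCast_nonneg k), Int.toNat_natCast, Nat.choose_symm_of_eq_add h.symm]

/-- Values at `(a, b, c)` with `a + b + c = d + 1` that satisfy the recursion imposed by
`x + y + z` are determined, on the orthant with corner `(a₀, b₀, c₀)`, by those with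
`c = c₀`. -/
lemma eq_of_recursion {d a₀ b₀ c₀ : ℕ} {Φ Ψ : ℕ → ℕ → ℕ → K}
    (hΦ : ∀ a b c, a + b + c = d → Φ (a + 1) b c + Φ a (b + 1) c + Φ a b (c + 1) = 0)
    (hΨ : ∀ a b c, a + b + c = d → Ψ (a + 1) b c + Ψ a (b + 1) c + Ψ a b (c + 1) = 0)
    (h0 : ∀ a b, a₀ ≤ a → b₀ ≤ b → a + b + c₀ = d + 1 → Φ a b c₀ = Ψ a b c₀) :
    ∀ a b c, a₀ ≤ a → b₀ ≤ b → c₀ ≤ c → a + b + c = d + 1 → Φ a b c = Ψ a b c := by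
  intro a b c ha hb hc
  induction c, hc using Nat.le_induction generalizing a b with
  | base => exact h0 a b ha hb
  | succ c hc ih =>
    intro h
    have h1 := hΦ a b c (by omega)
    have h2 := hΨ a b c (by omega)
    rw [ih (a + 1) b (by omega) hb (by omega), ih a (b + 1) ha (by omega) (by omega)] at h1
    rw [← h2] at h1
    exact add_left_cancel h1

variable {α β γ t s : ℕ}

lemma matrixSize_eq (hs : α + β + γ = 3 * s) (hγ : γ ≤ 2 * s) (ht : s ≤ t) :
    matrixSize α β γ t = t + s - γ := by
  rw [matrixSize]
  omega

/-- The upper rows of the matrix give the values at `x^(α+i) y^(β+t-s-1-i) z^γ`. -/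
lemma wlpMatrix_mulVec_upper (hs : α + β + γ = 3 * s) (hαβ : α ≤ β)
    (hβγ : β ≤ γ) (hγ : γ ≤ 2 * s) (ht : s ≤ t) (u : Fin (matrixSize α β γ t) → K)
    (i : Fin (matrixSize α β γ t)) (hi : (i : ℕ) < t - s) :
    windowFunctional (2 * s - β) u (elimPoly (α + i) γ) =
      (-1) ^ γ * (((wlpMatrix α β γ t).map (Int.cast : ℤ → K)).mulVec u) i := by
  have hsize := matrixSize_eq hs hγ ht
  rw [windowFunctional_apply, Matrix.mulVec, dotProduct, Finset.mul_sum]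
  refine Finset.sum_congr rfl fun j _ => ?_
  have hj := j.2
  rw [coeff_elimPoly, Matrix.map_apply, wlpMatrix, Matrix.of_apply]
  have h3 : ((α : ℤ) + β + γ) / 3 = s := by omega
  simp only [h3]
  rw [if_pos (show ((i : ℕ) : ℤ) < (t : ℤ) - s by omega)]
  split_ifs with h
  · by_cases hk : (j : ℕ) ≤ s + i
    · have : (s : ℤ) + ((i : ℕ) : ℤ) - ((j : ℕ) : ℤ) = ((s + i - j : ℕ) : ℤ) := by omega
      rw [this, binom_add _ _ (2 * s - β + j - (α + i)) (by omega), Int.cast_natCast]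
      ring
    · rw [binom, if_neg (by omega), Nat.choose_eq_zero_of_lt (by omega)]
      simp
  · have : binom γ ((s : ℤ) + ((i : ℕ) : ℤ) - ((j : ℕ) : ℤ)) = 0 := by
      rw [binom]
      split_ifs with h'
      · rw [Nat.choose_eq_zero_of_lt (by omega)]
        rfl
      · rfl
    rw [this]
    simp

/-- The lower rows of the matrix give the values at `x^a y^(2s-γ-1-a) z^(γ+t)`, in decreasing
order of `a`. -/
lemma wlpMatrix_mulVec_lower (hs : α + β + γ = 3 * s) (hα : 0 < α) (hαβ : α ≤ β)
    (hβγ : β ≤ γ) (hγ : γ ≤ 2 * s) (ht : s ≤ t) (u : Fin (matrixSize α β γ t) → K)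
    (i : Fin (matrixSize α β γ t)) (a : ℕ) (hi : (i : ℕ) + a + γ + 1 = t + s) (ha : a < 2 * s - γ) :
    windowFunctional (2 * s - β) u (elimPoly a (γ + t)) =
      (-1) ^ (γ + t) * (((wlpMatrix α β γ t).map (Int.cast : ℤ → K)).mulVec u) i := by
  have hsize := matrixSize_eq hs hγ ht
  rw [windowFunctional_apply, Matrix.mulVec, dotProduct, Finset.mul_sum]
  refine Finset.sum_congr rfl fun j _ => ?_
  have hj := j.2
  rw [coeff_elimPoly, Matrix.map_apply, wlpMatrix, Matrix.of_apply]
  have h3 : ((α : ℤ) + β + γ) / 3 = s := by omega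
  simp only [h3]
  rw [if_neg (show ¬((i : ℕ) : ℤ) < (t : ℤ) - s by omega)]
  split_ifs with h
  · by_cases hk : 2 * s - β + j - a ≤ γ + t
    · have : (t : ℤ) + β - 1 - (((i : ℕ) : ℤ) - ((t : ℤ) - s)) - ((j : ℕ) : ℤ) =
          ((γ + t - (2 * s - β + j - a) : ℕ) : ℤ) := by omega
      rw [this, binom_add _ _ (2 * s - β + j - a) (by omega), Int.cast_natCast]
      ring
    · rw [binom, if_neg (by omega), Nat.choose_eq_zero_of_lt (by omega)]
      simp
  · have : binom (γ + t) ((t : ℤ) + β - 1 - (((i : ℕ) : ℤ) - ((t : ℤ) - s)) -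
        ((j : ℕ) : ℤ)) = 0 := by
      rw [binom]
      split_ifs with h'
      · rw [Nat.choose_eq_zero_of_lt (by omega)]
        rfl
      · rfl
    rw [this]
    simp

/-- Eliminating `z` identifies the functionals on the critical degree that kill the ideal and the
multiples of `x + y + z` with the kernel of the matrix of binomial coefficients. -/
lemma exists_functional_iff_det_eq_zero (hs : α + β + γ = 3 * s) (hα : 0 < α) (hαβ : α ≤ β)
    (hβγ : β ≤ γ) (hγ : γ ≤ 2 * s) (ht : s ≤ t) :
    (∃ φ : (Fin 3 →₀ ℕ) → K, (∃ m, m.degree = 2 * s + t - 2 + 1 ∧ φ m ≠ 0) ∧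
        (∀ m ∈ aciExps α β γ t, φ m = 0) ∧
        ∀ m, m.degree = 2 * s + t - 2 → ∑ i, φ (m + Finsupp.single i 1) = 0) ↔
      ((wlpMatrix α β γ t).map (Int.cast : ℤ → K)).det = 0 := by
  have hsize := matrixSize_eq hs hγ ht
  rw [← Matrix.exists_mulVec_eq_zero_iff]
  have hrec : ∀ (lam : Polynomial K →ₗ[K] K) (a c : ℕ),
      lam (elimPoly (a + 1) c) + lam (elimPoly a c) + lam (elimPoly a (c + 1)) = 0 := by
    intro lam a c
    rw [← map_add, ← map_add, elimPoly_relation, map_zero]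
  constructor
  · rintro ⟨φ, ⟨m, hm, hne⟩, hφU, hφ⟩
    let u : Fin (matrixSize α β γ t) → K := fun j =>
      φ (expVec (2 * s - β + j) (t + β - 1 - j) 0)
    have hφrec : ∀ a b c, a + b + c = 2 * s + t - 2 →
        φ (expVec (a + 1) b c) + φ (expVec a (b + 1) c) + φ (expVec a b (c + 1)) = 0 := by
      intro a b c h
      rw [← hφ (expVec a b c) (by rw [degree_fin_three]; simpa using h), Fin.sum_univ_three]
      congr 2 <;> [congr 1; skip; skip] <;> congr 1 <;> apply exp_ext <;> simp
    have hval : ∀ a b c, a + b + c = 2 * s + t - 2 + 1 →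
        φ (expVec a b c) = windowFunctional (2 * s - β) u (elimPoly a c) := by
      intro a b c h
      refine eq_of_recursion (a₀ := 0) (b₀ := 0) (c₀ := 0) (Φ := fun a b c => φ (expVec a b c))
        (Ψ := fun a _ c => windowFunctional (2 * s - β) u (elimPoly a c)) hφrec
        (fun a _ c _ => hrec _ a c) ?_ a b c (by omega) (by omega) (by omega) h
      intro a b _ _ hab
      rw [windowFunctional_apply]
      simp only [elimPoly, pow_zero, mul_one, Polynomial.coeff_X_pow]
      by_cases hr : 2 * s - β ≤ a ∧ a < α + t
      · rw [Finset.sum_eq_single ⟨a - (2 * s - β), by omega⟩]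
        · rw [if_pos (by simp only; omega), mul_one]
          simp only [u]
          congr 2 <;> omega
        · intro j _ hj
          rw [if_neg, mul_zero]
          intro h
          exact hj (Fin.ext (by simp only; omega))
        · simp
      · rw [hφU, Finset.sum_eq_zero]
        · intro j _
          have := j.2
          rw [if_neg (by omega), mul_zero]
        · rw [mem_aciExps]
          simp only [expVec_zero, expVec_one, expVec_two]
          omega
    refine ⟨u, ?_, ?_⟩
    · intro hu
      apply hne
      have : m = expVec (m 0) (m 1) (m 2) := exp_ext rfl rfl rfl
      rw [degree_fin_three] at hm
      rw [this, hval _ _ _ hm, windowFunctional_apply, hu]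
      simp
    · funext i
      have hi := i.2
      have hsign : ∀ k : ℕ, ((-1 : K)) ^ k ≠ 0 := fun k => pow_ne_zero _ (by simp)
      by_cases hit : (i : ℕ) < t - s
      · have := wlpMatrix_mulVec_upper hs hαβ hβγ hγ ht u i hit
        rw [← hval _ (β + (t - s - 1 - i)) _ (by omega), hφU] at this
        · exact (mul_eq_zero.1 this.symm).resolve_left (hsign _)
        · rw [mem_aciExps]
          simp
      · have := wlpMatrix_mulVec_lower hs hα hαβ hβγ hγ ht u i (t + s - γ - 1 - i)
          (by omega) (by omega)
        rw [← hval _ (2 * s - γ - 1 - (t + s - γ - 1 - i)) _ (by omega), hφU] at this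
        · exact (mul_eq_zero.1 this.symm).resolve_left (hsign _)
        · rw [mem_aciExps]
          simp
  · rintro ⟨u, hu, hMu⟩
    set lam := windowFunctional (2 * s - β) u with hlam
    let Φ : ℕ → ℕ → ℕ → K := fun a b c =>
      if a + b + c = 2 * s + t - 2 + 1 then lam (elimPoly a c) else 0
    have hΦrec : ∀ a b c, a + b + c = 2 * s + t - 2 →
        Φ (a + 1) b c + Φ a (b + 1) c + Φ a b (c + 1) = 0 := by
      intro a b c h
      simp only [Φ]
      rw [if_pos (by omega), if_pos (by omega), if_pos (by omega), hrec]
    refine ⟨fun m => Φ (m 0) (m 1) (m 2), ?_, ?_, ?_⟩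
    · obtain ⟨j, hj⟩ := Function.ne_iff.1 hu
      have hj2 := j.2
      refine ⟨expVec (2 * s - β + j) (t + β - 1 - j) 0, ?_, ?_⟩
      · rw [degree_fin_three]
        simp only [expVec_zero, expVec_one, expVec_two]
        omega
      · simp only [expVec_zero, expVec_one, expVec_two, Φ]
        rw [if_pos (by omega), hlam, windowFunctional_apply, Finset.sum_eq_single j]
        · simpa [elimPoly, Polynomial.coeff_X_pow] using hj
        · intro k _ hk
          simp only [elimPoly, pow_zero, mul_one, Polynomial.coeff_X_pow]
          rw [if_neg, mul_zero]
          intro h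
          exact hk (Fin.ext (by omega))
        · simp
    · intro m hm
      by_cases hd : m 0 + m 1 + m 2 = 2 * s + t - 2 + 1
      swap
      · exact if_neg hd
      rw [mem_aciExps] at hm
      rcases hm with h | h | h | ⟨h0, h1, h2⟩
      · -- The power of `X` exceeds the window.
        simp only [Φ]
        rw [if_pos hd, hlam, windowFunctional_apply]
        refine Finset.sum_eq_zero fun j _ => ?_
        have := j.2
        rw [coeff_elimPoly, if_neg (by omega), mul_zero]
      · -- The degree in `X` is below the window.
        simp only [Φ]
        rw [if_pos hd, hlam, windowFunctional_apply]
        refine Finset.sum_eq_zero fun j _ => ?_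
        rw [coeff_elimPoly, Nat.choose_eq_zero_of_lt (by omega)]
        simp
      · refine eq_of_recursion (a₀ := 0) (b₀ := 0) (c₀ := γ + t) (Ψ := fun _ _ _ => 0)
          hΦrec (by simp) ?_ _ _ _
          (by omega) (by omega) h hd
        intro a b _ _ hab
        simp only [Φ]
        rw [if_pos hab, hlam, wlpMatrix_mulVec_lower hs hα hαβ hβγ hγ ht u
          ⟨t + s - γ - 1 - a, by omega⟩ a (by simp only; omega) (by omega), hMu]
        simp
      · refine eq_of_recursion (a₀ := α) (b₀ := β) (c₀ := γ) (Ψ := fun _ _ _ => 0)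
          hΦrec (by simp) ?_ _ _ _ h0 h1 h2 hd
        intro a b ha hb hab
        obtain ⟨i, rfl⟩ := exists_add_of_le ha
        simp only [Φ]
        rw [if_pos hab, hlam]
        have := wlpMatrix_mulVec_upper hs hαβ hβγ hγ ht u ⟨i, by omega⟩ (by simp only; omega)
        simp only at this
        rw [this, hMu]
        simp
    · intro m hm
      rw [degree_fin_three] at hm
      rw [Fin.sum_univ_three, ← hΦrec _ _ _ hm]
      simp

/-! ### The weak Lefschetz property -/

lemma hasWLP_aciIdeal_iff (hs : α + β + γ = 3 * s) (hα : 0 < α) (hαβ : α ≤ β) (hβγ : β ≤ γ)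
    (hγs : γ ≤ 2 * s) (hst : s ≤ t) :
    HasWLP (aciIdeal K α β γ t) ↔
      ((wlpMatrix α β γ t).map (Int.cast : ℤ → K)).det ≠ 0 := by
  have ht0 : 0 < t := by omega
  have hI := isMonomialWith_aciIdeal K α β γ t
  let e : stdExps (aciExps α β γ t) (2 * s + t - 2) ≃
      stdExps (aciExps α β γ t) (2 * s + t - 2 + 1) :=
    Finset.equivOfCardEq (card_stdExps_eq hs hα hαβ hβγ hγs hst)
  have hcrit : (sqMulMatrix e (∑ i, X i : MvPolynomial (Fin 3) K)).det = 0 ↔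
      ((wlpMatrix α β γ t).map (Int.cast : ℤ → K)).det = 0 :=
    (det_sqMulMatrix_sum_X_eq_zero_iff (fun m hm i => aciExps_add_single hm i) e).trans
      (exists_functional_iff_det_eq_zero hs hα hαβ hβγ hγs hst)
  rw [Ne, ← hcrit]
  constructor
  · rintro ⟨ℓ, hℓ, h⟩
    obtain ⟨L, hL, rfl⟩ := mem_gradedPiece.1 hℓ
    refine det_sqMulMatrix_sum_X_ne_zero e (L := L) ?_
    rcases h (2 * s + t - 2) with h | h
    · exact (hI.injOn_iff_det_ne_zero e hL).1 h
    · exact (hI.surjOn_iff_det_ne_zero e hL).1 h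
  · intro h
    have hL : (∑ i, X i : MvPolynomial (Fin 3) K).IsHomogeneous 1 :=
      IsHomogeneous.sum _ _ _ fun i _ => isHomogeneous_X K i
    refine ⟨_, mk_mem_gradedPiece hL, fun j => ?_⟩
    rcases le_total j (2 * s + t - 2) with hj | hj
    · left
      induction hj using Nat.decreasingInduction with
      | self => exact (hI.injOn_iff_det_ne_zero e hL).2 h
      | of_succ k hk ih => exact hI.injOn_mul_of_succ (socle_aciIdeal K ht0) (by omega) ih
    · right
      induction j, hj using Nat.le_induction with
      | base => exact (hI.surjOn_iff_det_ne_zero e hL).2 h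
      | succ k hk ih => exact surjOn_mul_succ ih

end Binomial

end WeakLefschetz

theorem theorem6p2 {K : Type*} [Field K] (p : ℕ) [CharP K p] (α β γ t : ℕ)
    (hα : 0 < α) (hαβ : α ≤ β) (hβγ : β ≤ γ) (hγ : γ ≤ 2 * (α + β))
    (ht : ((α : ℚ) + β + γ) / 3 ≤ t) (hmod : α + β + γ ≡ 0 [MOD 3]) :
    WeakLefschetz.IsLevel (WeakLefschetz.aciIdeal K α β γ t) ∧
    (WeakLefschetz.matrixSize α β γ t : ℚ) = t + ((α : ℚ) + β - 2 * γ) / 3 ∧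
    (WeakLefschetz.HasWLP (WeakLefschetz.aciIdeal K α β γ t) ↔
      ¬ (WeakLefschetz.wlpMatrix α β γ t).det ≡ 0 [ZMOD (p : ℤ)]) := by
  obtain ⟨s, hs⟩ : 3 ∣ α + β + γ := (Nat.modEq_zero_iff_dvd).1 hmod
  have hsQ : (α : ℚ) + β + γ = 3 * s := by exact_mod_cast hs
  have hst : s ≤ t := by
    have : (s : ℚ) ≤ t := by linarith
    exact_mod_cast this
  have hγs : γ ≤ 2 * s := by omega
  have ht0 : 0 < t := by omega
  refine ⟨WeakLefschetz.isLevel_aciIdeal K ht0, ?_, ?_⟩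
  · rw [WeakLefschetz.matrixSize_eq hs hγs hst, Nat.cast_sub (by omega)]
    push_cast
    linarith
  rw [WeakLefschetz.hasWLP_aciIdeal_iff hs hα hαβ hβγ hγs hst, Int.modEq_zero_iff_dvd,
    ← CharP.intCast_eq_zero_iff K p, Int.cast_det]
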